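/- **Theorem.** Consider the hard-constraint size-stochastic knapsack problem: items $1,\dots,n$ arrive in this order at a knapsack of capacity $1$; their sizes $S_1,\dots,S_n$ are independent random variables with known distributions $F_1,\dots,F_n$ on $[0,1]$, and $\sum_{i=1}^n\mathbb{E}[S_i]\le 1$. When item $i$ arrives, a policy either discards it or tries to insert it, without knowing $S_i$. Let $W_i$ be the usage of the knapsack just before item $i$ is processed, so $W_1=0$, $W_{i+1}=W_i+S_i$ if item $i$ is tried, and $W_{i+1}=W_i$ otherwise. A tried item is accepted if $W_i+S_i\le 1$; if $W_i+S_i>1$, it is rejected, the usage exceeds $1$ from then on, and no later item is tried. For $\gamma>0$, the $\gamma$-aggressive policy treats item $i$ with a threshold $\theta_i$ and a probability $q_i\in[0,1]$, using independent coins: if $\theta_i<W_i\le 1$, it tries item $i$; if $W_i=\theta_i$, it tries item $i$ with probability $q_i$; otherwise it discards item $i$. Here $$\theta_i=\inf\Theta_i,\qquad \Theta_i=\{\theta\in[0,1] : \Pr[\theta\le W_i\le 1-S_i]\ge\gamma\},\qquad q_i=\frac{\gamma-\Pr[\theta_i<W_i\le 1-S_i]}{\Pr[\theta_i=W_i\le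 1-S_i]},$$ where $q_i\in[0,1]$ is arbitrary if the denominator is $0$. Such parameters exist for item $i$ if $\Theta_i\neq\emptyset$ and, when the denominator is nonzero, the quotient lies in $[0,1]$. The policy is *feasible* if such $\theta_i$ and $q_i$ exist for every item $i$. For every $\gamma\in(0,1/3]$ and every instance, the $\gamma$-aggressive policy is feasible: such parameters exist for all items, and, whatever admissible parameters were used for items $1,\dots,i-1$, admissible parameters exist for item $i$. Moreover, with any such parameters every item is accepted with probability exactly $\gamma$. The same holds if $\theta_i=\sup\Theta_i$ is used throughout in place of $\theta_i=\inf\Theta_i$. -/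

import Mathlib

open MeasureTheory ProbabilityTheory Set

noncomputable section

namespace KOCRS

/-- An instance of the knapsack problem with `n` items arriving in the order `0, 1, …, n - 1`:
size distributions `F i` on `[0,1]` with total expected size at most the capacity `1`. -/
structure IsInstance {n : ℕ} (F : Fin n → Measure ℝ) : Prop where
  isProbabilityMeasure : ∀ i, IsProbabilityMeasure (F i)
  size_mem : ∀ i, ∀ᵐ s ∂F i, s ∈ Icc (0 : ℝ) 1
  sum_mean_le : ∑ i, ∫ s, s ∂F i ≤ 1

/-- The randomness of a run: sizes `S i` with law `F i` and internal coins `C i` of the policy,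
uniform on `[0,1]`, all of them mutually independent. -/
structure IsRealization {n : ℕ} {Ω : Type*} [MeasurableSpace Ω] (μ : Measure Ω)
    (F : Fin n → Measure ℝ) (S C : Fin n → Ω → ℝ) : Prop where
  measurable_size : ∀ i, Measurable (S i)
  measurable_coin : ∀ i, Measurable (C i)
  map_size : ∀ i, μ.map (S i) = F i
  map_coin : ∀ i, μ.map (C i) = volume.restrict (Icc (0 : ℝ) 1)
  indep : iIndepFun (Sum.elim S C) μ

/-- The decision to try to insert an item, given the current usage `w`, the threshold `t`, the
tie-breaking probability `p` and the coin `c`.  A usage `w > 1` records that a critical item has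
already overflowed the knapsack; nothing is tried any more after that. -/
def Tries (t p w c : ℝ) : Prop :=
  w ≤ 1 ∧ (t < w ∨ (w = t ∧ c ≤ p))

open Classical in
/-- `usage θ q S C i.castSucc` is the usage `W_i` of the knapsack just before item `i` is processed
and `usage θ q S C i.succ` the usage just after it, for the threshold policy with thresholds `θ` and
tie-breaking probabilities `q`.  The size of a critical (overflowing) item is counted, so that the
usage exceeds `1` from then on. -/
def usage {n : ℕ} {Ω : Type*} (θ q : Fin n → ℝ) (S C : Fin n → Ω → ℝ) :
    Fin (n + 1) → Ω → ℝ :=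
  Fin.induction (motive := fun _ => Ω → ℝ) (fun _ => 0)
    (fun i W ω => if Tries (θ i) (q i) (W ω) (C i ω) then W ω + S i ω else W ω)

/-- Item `i` is accepted under the hard constraint: it is tried and it fits. -/
def accepted {n : ℕ} {Ω : Type*} (θ q : Fin n → ℝ) (S C : Fin n → Ω → ℝ) (i : Fin n) : Set Ω :=
  {ω | Tries (θ i) (q i) (usage θ q S C i.castSucc ω) (C i ω) ∧
    usage θ q S C i.castSucc ω + S i ω ≤ 1}

/-- The set `{θ ∈ [0,1] | Pr[θ ≤ W ≤ 1 - S] ≥ γ}`. -/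
def thresholdSet {Ω : Type*} [MeasurableSpace Ω] (μ : Measure Ω) (γ : ℝ) (W S : Ω → ℝ) : Set ℝ :=
  {t | t ∈ Icc (0 : ℝ) 1 ∧ γ ≤ μ.real {ω | t ≤ W ω ∧ W ω ≤ 1 - S ω}}

/-- `t` and `p` are a threshold and a tie-breaking probability that the `γ`-aggressive policy may
use for an item of size `S` that meets the usage `W`: `t` is the extremum `opt` (infimum or
supremum) of the nonempty set `thresholdSet μ γ W S`, and `p ∈ [0,1]` equals
`(γ - Pr[t < W ≤ 1 - S]) / Pr[t = W ≤ 1 - S]`, being arbitrary in `[0,1]` if the denominator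
vanishes. -/
structure IsAggressiveChoice {Ω : Type*} [MeasurableSpace Ω] (opt : Set ℝ → ℝ) (μ : Measure Ω)
    (γ : ℝ) (W S : Ω → ℝ) (t p : ℝ) : Prop where
  nonempty : (thresholdSet μ γ W S).Nonempty
  threshold_eq : t = opt (thresholdSet μ γ W S)
  prob_mem : p ∈ Icc (0 : ℝ) 1
  prob_eq : μ.real {ω | t = W ω ∧ W ω ≤ 1 - S ω} ≠ 0 →
    p = (γ - μ.real {ω | t < W ω ∧ W ω ≤ 1 - S ω}) / μ.real {ω | t = W ω ∧ W ω ≤ 1 - S ω}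

/-- The parameters `θ`, `q` follow the rule of the `γ`-aggressive policy for item `i`. -/
def FollowsAt {n : ℕ} {Ω : Type*} [MeasurableSpace Ω] (opt : Set ℝ → ℝ) (μ : Measure Ω)
    (γ : ℝ) (S C : Fin n → Ω → ℝ) (θ q : Fin n → ℝ) (i : Fin n) : Prop :=
  IsAggressiveChoice opt μ γ (usage θ q S C i.castSucc) (S i) (θ i) (q i)

/-- The `γ`-aggressive policy is feasible: suitable thresholds and tie-breaking probabilities exist
for every item.  Moreover the policy never gets stuck, whatever admissible parameters
were used for the earlier items. -/
structure Feasible {n : ℕ} {Ω : Type*} [MeasurableSpace Ω] (opt : Set ℝ → ℝ) (μ : Measure Ω)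
    (γ : ℝ) (S C : Fin n → Ω → ℝ) : Prop where
  exists_params : ∃ θ q : Fin n → ℝ, ∀ i, FollowsAt opt μ γ S C θ q i
  never_stuck : ∀ (θ q : Fin n → ℝ) (i : Fin n), (∀ j < i, FollowsAt opt μ γ S C θ q j) →
    ∃ t p : ℝ, IsAggressiveChoice opt μ γ (usage θ q S C i.castSucc) (S i) t p

end KOCRS

end

/-!
Writing `W` for the usage that an item of size `S` meets, three facts survive every item: `0 ≤ W`,
`Pr[0 < W ≤ 1] ≤ γ`, and `E[W]` is at most `2 γ` times the total expected size `m` of the earlier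
items.

If the item does not fit then `1 ≤ W + S · 1{0 < W ≤ 1}`, so it fits with probability at least
`1 - γ (2 m + E[S])`, which is at least `γ` as soon as `γ (1 + 2 (m + E[S])) ≤ 1`. The set of
candidate thresholds is then an interval `[0, a]`, and any `θ` in it gives a tie-breaking
probability in `[0,1]`, because `Pr[θ < W ≤ 1 - S] ≤ Pr[0 < W ≤ 1] ≤ γ`. By independence of the coin
the acceptance probability is exactly `γ`.

An item is tried only if it is accepted or `0 < W ≤ 1`, so it is tried with probability at most
`2 γ`; since `S` is independent of that decision, `E[W]` grows by at most `2 γ E[S]`. Finally, if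
`θ = 0` a knapsack that is neither empty nor overflowed after the item has just accepted it, and if
`θ > 0` it was already in that state before; either event has probability at most `γ`.
-/

namespace KOCRS

section Recursion

lemma exists_forall_of_exists_update {ι α : Type*} [PartialOrder ι] [WellFoundedLT ι]
    [DecidableEq ι] [Nonempty α] {P : (ι → α) → ι → Prop}
    (hcongr : ∀ ⦃f g i⦄, (∀ j ≤ i, f j = g j) → P f i → P g i)
    (hext : ∀ f i, (∀ j < i, P f j) → ∃ a, P (Function.update f i a) i) :
    ∃ f, ∀ i, P f i := by
  classical
  let extend (i : ι) (r : ∀ j, j < i → α) : ι → α :=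
    fun j => if h : j < i then r j h else Classical.arbitrary α
  let next (i : ι) (r : ∀ j, j < i → α) : α :=
    Classical.epsilon fun a => P (Function.update (extend i r) i a) i
  let f : ι → α := wellFounded_lt.fix next
  refine ⟨f, fun i => ?_⟩
  induction i using WellFoundedLT.induction with
  | ind i ih =>
    have hf : f i = next i fun j _ => f j := wellFounded_lt.fix_eq next i
    have hagree : ∀ j < i, extend i (fun j _ => f j) j = f j := fun j hj => dif_pos hj
    have hnext := Classical.epsilon_spec <| hext (extend i fun j _ => f j) i fun j hj =>
      hcongr (fun k hk => (hagree k (hk.trans_lt hj)).symm) (ih j hj)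
    refine hcongr (fun j hj => ?_) hnext
    rcases hj.eq_or_lt with rfl | hj
    · rw [Function.update_self, hf]
    · rw [Function.update_of_ne hj.ne, hagree j hj]

end Recursion

section MeasureTheory

variable {Ω : Type*} [MeasurableSpace Ω] {μ : Measure Ω}

lemma measureReal_mono_of_ae [IsFiniteMeasure μ] {A B : Set Ω}
    (h : ∀ᵐ ω ∂μ, ω ∈ A → ω ∈ B) : μ.real A ≤ μ.real B :=
  ENNReal.toReal_mono (measure_ne_top μ _) (measure_mono_ae h)

lemma le_measureReal_Ici_csSup {α : Type*} [ConditionallyCompleteLinearOrder α]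
    [TopologicalSpace α] [OrderTopology α] [FirstCountableTopology α] [MeasurableSpace α]
    [OpensMeasurableSpace α] {ν : Measure α} [IsFiniteMeasure ν] {c : ℝ} {s : Set α}
    (hne : s.Nonempty) (hbdd : BddAbove s) (h : ∀ t ∈ s, c ≤ ν.real (Ici t)) :
    c ≤ ν.real (Ici (sSup s)) := by
  obtain ⟨u, hu_mono, hu_lim, hu_mem⟩ := exists_seq_tendsto_sSup hne hbdd
  have hinter : ⋂ n, Ici (u n) = Ici (sSup s) := by
    ext x
    simp only [mem_iInter, mem_Ici]
    exact ⟨le_of_tendsto' hu_lim, fun hx n => (le_csSup hbdd (hu_mem n)).trans hx⟩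
  have hlim := tendsto_measure_iInter_atTop (μ := ν) (s := fun n => Ici (u n))
    (fun n => measurableSet_Ici.nullMeasurableSet) (fun m n hmn => Ici_subset_Ici.2 (hu_mono hmn))
    ⟨0, measure_ne_top ν _⟩
  rw [hinter] at hlim
  exact ge_of_tendsto' ((ENNReal.tendsto_toReal (measure_ne_top ν _)).comp hlim)
    fun n => h _ (hu_mem n)

lemma measureReal_Ici_eq_add {α : Type*} [LinearOrder α] [MeasurableSpace α]
    [MeasurableSingletonClass α] (ν : Measure α) [IsFiniteMeasure ν] (t : α) :
    ν.real (Ici t) = ν.real (Ioi t) + ν.real {t} := by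
  rw [← measureReal_union (disjoint_singleton_right.2 self_notMem_Ioi) (measurableSet_singleton t),
    Ioi_union_left]

end MeasureTheory

section Info

variable {Ω ι β : Type*} [MeasurableSpace β] {X : ι → Ω → β} {A B : Set ι}

/-- The σ-algebra generated by the random variables `X i` with `i ∈ A`: the information available
once these have been observed. -/
abbrev info (X : ι → Ω → β) (A : Set ι) : MeasurableSpace Ω :=
  ⨆ i ∈ A, MeasurableSpace.comap (X i) inferInstance

lemma measurable_info {i : ι} (hi : i ∈ A) : Measurable[info X A] (X i) :=
  measurable_iff_comap_le.2 (le_iSup₂_of_le i hi le_rfl)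

lemma info_mono (h : A ⊆ B) : info X A ≤ info X B :=
  biSup_mono h

lemma indepFun_of_measurable_info [MeasurableSpace Ω] {μ : Measure Ω} {γ δ : Type*}
    [MeasurableSpace γ] [MeasurableSpace δ] {Y : Ω → γ} {Z : Ω → δ}
    (hX : ∀ i, Measurable (X i)) (hindep : iIndepFun X μ) (hAB : Disjoint A B)
    (hY : Measurable[info X A] Y) (hZ : Measurable[info X B] Z) : IndepFun Y Z μ :=
  indep_of_indep_of_le_left (indep_of_indep_of_le_right
    (indep_iSup_of_disjoint (fun i => (hX i).comap_le) hindep.iIndep hAB) hZ.comap_le) hY.comap_le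

end Info

section SingleItem

variable {Ω : Type*} {γ M t p : ℝ} {W S C : Ω → ℝ}

/-- The event that an item with coin `C` that meets the usage `W` is tried. -/
def tried (t p : ℝ) (W C : Ω → ℝ) : Set Ω :=
  {ω | Tries t p (W ω) (C ω)}

/-- The event that there is room for an item of size `S` that meets the usage `W`. -/
def fits (W S : Ω → ℝ) : Set Ω :=
  {ω | W ω + S ω ≤ 1}

lemma preimage_Ioc_add_indicator_tried_subset (ht : 0 ≤ t) :
    (W + (tried t p W C).indicator S) ⁻¹' Ioc 0 1 ⊆ tried t p W C ∩ fits W S ∨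
      (W + (tried t p W C).indicator S) ⁻¹' Ioc 0 1 ⊆ W ⁻¹' Ioc 0 1 := by
  rcases ht.eq_or_lt with rfl | ht
  · refine Or.inl fun ω hω => ?_
    by_cases htried : ω ∈ tried 0 p W C
    · simp only [mem_preimage, Pi.add_apply, indicator_of_mem htried] at hω
      exact ⟨htried, hω.2⟩
    · simp only [mem_preimage, Pi.add_apply, indicator_of_notMem htried, add_zero] at hω
      exact absurd ⟨hω.2, Or.inl hω.1⟩ htried
  · refine Or.inr fun ω hω => ?_
    by_cases htried : ω ∈ tried t p W C
    · exact ⟨htried.2.elim ht.trans fun h => h.1 ▸ ht, htried.1⟩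
    · simpa only [mem_preimage, Pi.add_apply, indicator_of_notMem htried, add_zero] using hω

variable [MeasurableSpace Ω] {μ : Measure Ω}

lemma measurableSet_tried (hW : Measurable W) (hC : Measurable C) :
    MeasurableSet (tried t p W C) :=
  (measurableSet_le hW measurable_const).inter
    ((measurableSet_lt measurable_const hW).union
      ((hW (measurableSet_singleton t)).inter (measurableSet_le hC measurable_const)))

lemma measurableSet_fits (hW : Measurable W) (hS : Measurable S) : MeasurableSet (fits W S) :=
  measurableSet_le (hW.add hS) measurable_const

/-- The law of the usage `W` restricted to the event that the item fits: its values on `Ici θ`,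
`Ioi θ` and `{θ}` are the probabilities `Pr[θ ≤ W ≤ 1 - S]`, `Pr[θ < W ≤ 1 - S]` and
`Pr[θ = W ≤ 1 - S]` that govern the `γ`-aggressive policy. -/
noncomputable def fitLaw (μ : Measure Ω) (W S : Ω → ℝ) : Measure ℝ :=
  (μ.restrict (fits W S)).map W

instance [IsFiniteMeasure μ] : IsFiniteMeasure (fitLaw μ W S) :=
  inferInstanceAs (IsFiniteMeasure ((μ.restrict (fits W S)).map W))

lemma fitLaw_real_apply (hW : Measurable W) {A : Set ℝ} (hA : MeasurableSet A) :
    (fitLaw μ W S).real A = μ.real (W ⁻¹' A ∩ fits W S) := by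
  rw [fitLaw, map_measureReal_apply hW hA, measureReal_restrict_apply (hW hA)]

/-- An item of size `S` in `[0,1]`, with a uniform coin `C`, that meets the usage `W`: its size is
independent of the decision whether to try it, and its coin of whether it ties and fits. -/
structure IsFreshItem (μ : Measure Ω) (W S C : Ω → ℝ) : Prop where
  measurable_size : Measurable S
  measurable_coin : Measurable C
  size_mem : ∀ᵐ ω ∂μ, S ω ∈ Icc (0 : ℝ) 1
  map_coin : μ.map C = volume.restrict (Icc (0 : ℝ) 1)
  indep_size : IndepFun (fun ω => (W ω, C ω)) S μ
  indep_coin : IndepFun C (fun ω => (W ω, S ω)) μ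

namespace IsFreshItem

lemma integrable_size [IsFiniteMeasure μ] (hI : IsFreshItem μ W S C) : Integrable S μ :=
  Integrable.of_mem_Icc 0 1 hI.measurable_size.aemeasurable hI.size_mem

lemma integral_size_nonneg (hI : IsFreshItem μ W S C) : 0 ≤ ∫ ω, S ω ∂μ :=
  integral_nonneg_of_ae (hI.size_mem.mono fun _ h => h.1)

lemma setIntegral_size (hI : IsFreshItem μ W S C) (hW : Measurable W) {A : Set (ℝ × ℝ)}
    (hA : MeasurableSet A) :
    ∫ ω in (fun ω => (W ω, C ω)) ⁻¹' A, S ω ∂μ =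
      μ.real ((fun ω => (W ω, C ω)) ⁻¹' A) * ∫ ω, S ω ∂μ :=
  Indep.setIntegral_eq_mul (hW.prodMk hI.measurable_coin).comap_le (f := id) hI.indep_size
    hI.measurable_size.aemeasurable ⟨A, hA, rfl⟩ aestronglyMeasurable_id

lemma measureReal_coin_le (hI : IsFreshItem μ W S C) (hp : p ∈ Icc (0 : ℝ) 1) :
    μ.real (C ⁻¹' Iic p) = p := by
  rw [← map_measureReal_apply hI.measurable_coin measurableSet_Iic, hI.map_coin,
    measureReal_restrict_apply measurableSet_Iic, ← Ici_inter_Iic, inter_left_comm, Iic_inter_Iic,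
    min_eq_left hp.2, Ici_inter_Iic, Real.volume_real_Icc_of_le hp.1, sub_zero]

lemma measureReal_coin_le_inter_tie (hI : IsFreshItem μ W S C) (hW : Measurable W)
    (hp : p ∈ Icc (0 : ℝ) 1) :
    μ.real (C ⁻¹' Iic p ∩ (W ⁻¹' {t} ∩ fits W S)) = p * (fitLaw μ W S).real {t} := by
  have hindep : μ (C ⁻¹' Iic p ∩ (W ⁻¹' {t} ∩ fits W S)) =
      μ (C ⁻¹' Iic p) * μ (W ⁻¹' {t} ∩ fits W S) :=
    hI.indep_coin.measure_inter_preimage_eq_mul (Iic p) (Prod.fst ⁻¹' {t} ∩ {x | x.1 + x.2 ≤ 1})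
      measurableSet_Iic ((measurable_fst (measurableSet_singleton t)).inter
        (measurableSet_le (measurable_fst.add measurable_snd) measurable_const))
  rw [measureReal_def, hindep, ENNReal.toReal_mul, ← measureReal_def, ← measureReal_def,
    hI.measureReal_coin_le hp, fitLaw_real_apply hW (measurableSet_singleton t)]

lemma measureReal_tried_inter_fits [IsFiniteMeasure μ] (hI : IsFreshItem μ W S C)
    (hW : Measurable W) (hp : p ∈ Icc (0 : ℝ) 1) :
    μ.real (tried t p W C ∩ fits W S) =
      (fitLaw μ W S).real (Ioi t) + p * (fitLaw μ W S).real {t} := by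
  have hsplit : (tried t p W C ∩ fits W S : Set Ω) =ᵐ[μ]
      (W ⁻¹' Ioi t ∩ fits W S ∪ C ⁻¹' Iic p ∩ (W ⁻¹' {t} ∩ fits W S) : Set Ω) := by
    filter_upwards [hI.size_mem] with ω hS
    have hle : ω ∈ fits W S → W ω ≤ 1 := fun (h : W ω + S ω ≤ 1) => by linarith [hS.1]
    apply propext
    change (W ω ≤ 1 ∧ (t < W ω ∨ W ω = t ∧ C ω ≤ p)) ∧ ω ∈ fits W S ↔
      (t < W ω ∧ ω ∈ fits W S) ∨ (C ω ≤ p ∧ W ω = t ∧ ω ∈ fits W S)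
    tauto
  have hdisj : Disjoint (W ⁻¹' Ioi t ∩ fits W S) (C ⁻¹' Iic p ∩ (W ⁻¹' {t} ∩ fits W S)) :=
    disjoint_left.2 fun _ h h' => (mem_Ioi.1 h.1).ne' h'.2.1
  have hmeas : MeasurableSet (C ⁻¹' Iic p ∩ (W ⁻¹' {t} ∩ fits W S)) :=
    (hI.measurable_coin measurableSet_Iic).inter
      ((hW (measurableSet_singleton t)).inter (measurableSet_fits hW hI.measurable_size))
  rw [measureReal_congr hsplit, measureReal_union hdisj hmeas,
    hI.measureReal_coin_le_inter_tie hW hp, fitLaw_real_apply hW measurableSet_Ioi]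

end IsFreshItem

lemma mem_thresholdSet_iff (hW : Measurable W) :
    t ∈ thresholdSet μ γ W S ↔ t ∈ Icc (0 : ℝ) 1 ∧ γ ≤ (fitLaw μ W S).real (Ici t) := by
  simp only [fitLaw_real_apply hW measurableSet_Ici, thresholdSet, le_sub_iff_add_le]
  rfl

lemma thresholdSet_eq_Icc [IsFiniteMeasure μ] (hW : Measurable W)
    (hne : (thresholdSet μ γ W S).Nonempty) :
    thresholdSet μ γ W S = Icc 0 (sSup (thresholdSet μ γ W S)) := by
  have hbdd : BddAbove (thresholdSet μ γ W S) := ⟨1, fun _ h => h.1.2⟩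
  have hsup_le : sSup (thresholdSet μ γ W S) ≤ 1 := csSup_le hne fun _ h => h.1.2
  have hsup : γ ≤ (fitLaw μ W S).real (Ici (sSup (thresholdSet μ γ W S))) :=
    le_measureReal_Ici_csSup hne hbdd fun _ h => ((mem_thresholdSet_iff hW).1 h).2
  refine Subset.antisymm (fun t ht => ⟨ht.1.1, le_csSup hbdd ht⟩) fun t ht => ?_
  exact (mem_thresholdSet_iff hW).2 ⟨⟨ht.1, ht.2.trans hsup_le⟩,
    hsup.trans (measureReal_mono (Ici_subset_Ici.2 ht.2))⟩

lemma opt_mem_thresholdSet [IsFiniteMeasure μ] {opt : Set ℝ → ℝ}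
    (hopt : ∀ a ∈ Icc (0 : ℝ) 1, opt (Icc 0 a) ∈ Icc 0 a) (hW : Measurable W)
    (hne : (thresholdSet μ γ W S).Nonempty) :
    opt (thresholdSet μ γ W S) ∈ thresholdSet μ γ W S := by
  have hIcc := thresholdSet_eq_Icc hW hne
  have hsup : sSup (thresholdSet μ γ W S) ∈ Icc (0 : ℝ) 1 :=
    ⟨Real.sSup_nonneg fun _ h => h.1.1, csSup_le hne fun _ h => h.1.2⟩
  rw [hIcc]
  exact hopt _ hsup

lemma IsAggressiveChoice.mem_thresholdSet [IsFiniteMeasure μ] {opt : Set ℝ → ℝ}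
    (h : IsAggressiveChoice opt μ γ W S t p)
    (hopt : ∀ a ∈ Icc (0 : ℝ) 1, opt (Icc 0 a) ∈ Icc 0 a) (hW : Measurable W) :
    t ∈ thresholdSet μ γ W S :=
  h.threshold_eq ▸ opt_mem_thresholdSet hopt hW h.nonempty

lemma isAggressiveChoice_iff (hW : Measurable W) {opt : Set ℝ → ℝ} :
    IsAggressiveChoice opt μ γ W S t p ↔
      (thresholdSet μ γ W S).Nonempty ∧ t = opt (thresholdSet μ γ W S) ∧ p ∈ Icc (0 : ℝ) 1 ∧
        ((fitLaw μ W S).real {t} ≠ 0 →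
          p = (γ - (fitLaw μ W S).real (Ioi t)) / (fitLaw μ W S).real {t}) := by
  have habove : μ.real {ω | t < W ω ∧ W ω ≤ 1 - S ω} = (fitLaw μ W S).real (Ioi t) := by
    simp only [fitLaw_real_apply hW measurableSet_Ioi, le_sub_iff_add_le]
    rfl
  have htie : μ.real {ω | t = W ω ∧ W ω ≤ 1 - S ω} = (fitLaw μ W S).real {t} := by
    simp only [fitLaw_real_apply hW (measurableSet_singleton t), le_sub_iff_add_le,
      eq_comm (a := t)]
    rfl
  rw [← habove, ← htie]
  exact ⟨fun h => ⟨h.nonempty, h.threshold_eq, h.prob_mem, h.prob_eq⟩,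
    fun ⟨hne, ht, hp, hp_eq⟩ => ⟨hne, ht, hp, hp_eq⟩⟩

lemma exists_isAggressiveChoice [IsFiniteMeasure μ] {opt : Set ℝ → ℝ} (hW : Measurable W)
    (hne : (thresholdSet μ γ W S).Nonempty)
    (hmem : opt (thresholdSet μ γ W S) ∈ thresholdSet μ γ W S)
    (hle : ∀ t, 0 ≤ t → (fitLaw μ W S).real (Ioi t) ≤ γ) :
    ∃ t p, IsAggressiveChoice opt μ γ W S t p := by
  set t := opt (thresholdSet μ γ W S) with ht
  have habove := hle t hmem.1.1
  have hfit := ((mem_thresholdSet_iff hW).1 hmem).2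
  rw [measureReal_Ici_eq_add] at hfit
  exact ⟨t, _, (isAggressiveChoice_iff hW).2 ⟨hne, ht,
    ⟨div_nonneg (by linarith) measureReal_nonneg,
      div_le_one_of_le₀ (by linarith) measureReal_nonneg⟩, fun _ => rfl⟩⟩

lemma IsAggressiveChoice.fitLaw_Ioi_add_mul_eq [IsFiniteMeasure μ] {opt : Set ℝ → ℝ}
    (h : IsAggressiveChoice opt μ γ W S t p) (hW : Measurable W)
    (ht : t ∈ thresholdSet μ γ W S) (hle : (fitLaw μ W S).real (Ioi t) ≤ γ) :
    (fitLaw μ W S).real (Ioi t) + p * (fitLaw μ W S).real {t} = γ := by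
  obtain ⟨-, -, -, hp⟩ := (isAggressiveChoice_iff hW).1 h
  by_cases htie : (fitLaw μ W S).real {t} = 0
  · have hfit := ((mem_thresholdSet_iff hW).1 ht).2
    rw [measureReal_Ici_eq_add] at hfit
    rw [htie]
    linarith
  · rw [hp htie, div_mul_cancel₀ _ htie, add_sub_cancel]

lemma fitLaw_Ioi_le [IsFiniteMeasure μ] (hW : Measurable W) (hS : ∀ᵐ ω ∂μ, 0 ≤ S ω)
    (ht : 0 ≤ t) : (fitLaw μ W S).real (Ioi t) ≤ μ.real (W ⁻¹' Ioc 0 1) := by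
  rw [fitLaw_real_apply hW measurableSet_Ioi]
  refine measureReal_mono_of_ae ?_
  filter_upwards [hS] with ω hS ⟨htW, (hfit : W ω + S ω ≤ 1)⟩
  exact ⟨ht.trans_lt htW, by linarith⟩

lemma one_le_add_indicator_of_one_lt_add {w s : ℝ} (hs : s ≤ 1) (h : 1 < w + s) :
    1 ≤ w + (Ioc (0 : ℝ) 1).indicator (fun _ => s) w := by
  rcases le_or_gt w 1 with hw1 | hw1
  · rw [indicator_of_mem (mem_Ioc.2 ⟨by linarith, hw1⟩)]
    exact h.le
  · rw [indicator_of_notMem fun hmem => hw1.not_ge hmem.2]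
    linarith

lemma IsFreshItem.one_sub_le_fitLaw_Ici_zero [IsProbabilityMeasure μ] (hI : IsFreshItem μ W S C)
    (hW : Measurable W) (hW_int : Integrable W μ) (hW_nonneg : ∀ᵐ ω ∂μ, 0 ≤ W ω) :
    1 - (∫ ω, W ω ∂μ + μ.real (W ⁻¹' Ioc 0 1) * ∫ ω, S ω ∂μ) ≤ (fitLaw μ W S).real (Ici 0) := by
  have hfits := measurableSet_fits hW hI.measurable_size
  have hpartial : MeasurableSet (W ⁻¹' Ioc 0 1) := hW measurableSet_Ioc
  have hS_int : Integrable ((W ⁻¹' Ioc 0 1).indicator S) μ := hI.integrable_size.indicator hpartial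
  have hmean : ∫ ω, (W ⁻¹' Ioc 0 1).indicator S ω ∂μ = μ.real (W ⁻¹' Ioc 0 1) * ∫ ω, S ω ∂μ := by
    rw [integral_indicator hpartial]
    exact hI.setIntegral_size hW (measurable_fst measurableSet_Ioc)
  have hmiss : μ.real (fits W S)ᶜ ≤ ∫ ω, (W ω + (W ⁻¹' Ioc 0 1).indicator S ω) ∂μ := by
    rw [← integral_indicator_one hfits.compl]
    refine integral_mono_ae ((integrable_const 1).indicator hfits.compl) (hW_int.add hS_int) ?_
    filter_upwards [hW_nonneg, hI.size_mem] with ω hw hs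
    refine indicator_apply_le' (fun hω => ?_) fun _ =>
      add_nonneg hw (indicator_apply_nonneg fun _ => hs.1)
    exact one_le_add_indicator_of_one_lt_add hs.2 (not_le.1 hω)
  have hfit : μ.real (fits W S) ≤ (fitLaw μ W S).real (Ici 0) := by
    rw [fitLaw_real_apply hW measurableSet_Ici]
    exact measureReal_mono_of_ae (hW_nonneg.mono fun _ hw hω => ⟨hw, hω⟩)
  rw [integral_add hW_int hS_int, hmean, probReal_compl_eq_one_sub hfits] at hmiss
  linarith

lemma measureReal_tried_le [IsFiniteMeasure μ] (hW : ∀ᵐ ω ∂μ, 0 ≤ W ω)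
    (hS : ∀ᵐ ω ∂μ, S ω ≤ 1) :
    μ.real (tried t p W C) ≤ μ.real (tried t p W C ∩ fits W S) + μ.real (W ⁻¹' Ioc 0 1) := by
  refine le_trans (measureReal_mono_of_ae ?_) (measureReal_union_le _ _)
  filter_upwards [hW, hS] with ω hw hs hω
  rcases hw.eq_or_lt with hw | hw
  · exact Or.inl ⟨hω, show W ω + S ω ≤ 1 by rwa [← hw, zero_add]⟩
  · exact Or.inr ⟨hw, hω.1⟩

lemma IsFreshItem.integral_add_indicator_tried [IsFiniteMeasure μ] (hI : IsFreshItem μ W S C)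
    (hW : Measurable W) (hW_int : Integrable W μ) :
    ∫ ω, (W + (tried t p W C).indicator S) ω ∂μ =
      ∫ ω, W ω ∂μ + μ.real (tried t p W C) * ∫ ω, S ω ∂μ := by
  have htried : MeasurableSet (tried t p W C) := measurableSet_tried hW hI.measurable_coin
  rw [integral_add' hW_int (hI.integrable_size.indicator htried), integral_indicator htried]
  congr 1
  exact hI.setIntegral_size hW (measurableSet_tried measurable_fst measurable_snd)

/-- The invariant kept by the usage `W` under the `γ`-aggressive policy, when the items processed so
far have total expected size `M`. -/
structure IsControlled (μ : Measure Ω) (γ M : ℝ) (W : Ω → ℝ) : Prop where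
  measurable : Measurable W
  integrable : Integrable W μ
  nonneg : ∀ᵐ ω ∂μ, 0 ≤ W ω
  prob_le : μ.real (W ⁻¹' Ioc 0 1) ≤ γ
  mean_le : ∫ ω, W ω ∂μ ≤ 2 * γ * M

namespace IsControlled

lemma fitLaw_Ioi_le [IsFiniteMeasure μ] (hc : IsControlled μ γ M W) (hI : IsFreshItem μ W S C)
    (ht : 0 ≤ t) : (fitLaw μ W S).real (Ioi t) ≤ γ :=
  (KOCRS.fitLaw_Ioi_le hc.measurable (hI.size_mem.mono fun _ h => h.1) ht).trans hc.prob_le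

lemma add_indicator_tried [IsFiniteMeasure μ] (hc : IsControlled μ γ M W)
    (hI : IsFreshItem μ W S C) (ht : 0 ≤ t) (haccept : μ.real (tried t p W C ∩ fits W S) ≤ γ) :
    IsControlled μ γ (M + ∫ ω, S ω ∂μ) (W + (tried t p W C).indicator S) := by
  have htried : MeasurableSet (tried t p W C) :=
    measurableSet_tried hc.measurable hI.measurable_coin
  have htried_le : μ.real (tried t p W C) ≤ 2 * γ := by
    have := measureReal_tried_le (μ := μ) (S := S) (t := t) (p := p) (C := C) hc.nonneg
      (hI.size_mem.mono fun _ h => h.2)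
    linarith [hc.prob_le]
  refine ⟨hc.measurable.add (hI.measurable_size.indicator htried),
    hc.integrable.add (hI.integrable_size.indicator htried), ?_, ?_, ?_⟩
  · filter_upwards [hc.nonneg, hI.size_mem] with ω hw hs
    exact add_nonneg hw (indicator_apply_nonneg fun _ => hs.1)
  · rcases preimage_Ioc_add_indicator_tried_subset ht with h | h
    · exact (measureReal_mono h).trans haccept
    · exact (measureReal_mono h).trans hc.prob_le
  · rw [hI.integral_add_indicator_tried hc.measurable hc.integrable, mul_add]
    exact add_le_add hc.mean_le (mul_le_mul_of_nonneg_right htried_le hI.integral_size_nonneg)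

lemma zero_mem_thresholdSet [IsProbabilityMeasure μ] (hc : IsControlled μ γ M W)
    (hI : IsFreshItem μ W S C) (hM : γ * (1 + 2 * (M + ∫ ω, S ω ∂μ)) ≤ 1) :
    0 ∈ thresholdSet μ γ W S := by
  refine (mem_thresholdSet_iff hc.measurable).2 ⟨⟨le_rfl, zero_le_one⟩, le_trans ?_
    (hI.one_sub_le_fitLaw_Ici_zero hc.measurable hc.integrable hc.nonneg)⟩
  have hγ : 0 ≤ γ := measureReal_nonneg.trans hc.prob_le
  have hmean := hc.mean_le
  have hpartial := mul_le_mul_of_nonneg_right hc.prob_le hI.integral_size_nonneg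
  have hsize := mul_nonneg hγ hI.integral_size_nonneg
  linarith

variable {opt : Set ℝ → ℝ}

lemma exists_isAggressiveChoice [IsProbabilityMeasure μ] (hc : IsControlled μ γ M W)
    (hI : IsFreshItem μ W S C) (hopt : ∀ a ∈ Icc (0 : ℝ) 1, opt (Icc 0 a) ∈ Icc 0 a)
    (hM : γ * (1 + 2 * (M + ∫ ω, S ω ∂μ)) ≤ 1) :
    ∃ t p, IsAggressiveChoice opt μ γ W S t p := by
  have hne : (thresholdSet μ γ W S).Nonempty := ⟨0, hc.zero_mem_thresholdSet hI hM⟩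
  exact KOCRS.exists_isAggressiveChoice hc.measurable hne
    (opt_mem_thresholdSet hopt hc.measurable hne) fun _ => hc.fitLaw_Ioi_le hI

lemma measureReal_tried_inter_fits [IsFiniteMeasure μ] (hc : IsControlled μ γ M W)
    (hI : IsFreshItem μ W S C) (hopt : ∀ a ∈ Icc (0 : ℝ) 1, opt (Icc 0 a) ∈ Icc 0 a)
    (h : IsAggressiveChoice opt μ γ W S t p) : μ.real (tried t p W C ∩ fits W S) = γ := by
  have ht : t ∈ thresholdSet μ γ W S := h.mem_thresholdSet hopt hc.measurable
  rw [hI.measureReal_tried_inter_fits hc.measurable h.prob_mem]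
  exact h.fitLaw_Ioi_add_mul_eq hc.measurable ht (hc.fitLaw_Ioi_le hI ht.1.1)

end IsControlled

end SingleItem

section Policy

lemma sum_castSucc_lt_succ {M : Type*} [AddCommMonoid M] {n : ℕ} (f : Fin n → M) (i : Fin n) :
    ∑ j with j.castSucc < i.succ, f j = ∑ j with j.castSucc < i.castSucc, f j + f i := by
  have hinsert : Finset.univ.filter (fun j : Fin n => j.castSucc < i.succ) =
      insert i (Finset.univ.filter fun j : Fin n => j.castSucc < i.castSucc) := by
    ext j
    simp [Fin.castSucc_lt_succ_iff, le_iff_eq_or_lt]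
  rw [hinsert, Finset.sum_insert (by simp), add_comm]

variable {Ω : Type*} {n : ℕ} {S C : Fin n → Ω → ℝ} {θ q θ' q' : Fin n → ℝ}

lemma usage_zero : usage θ q S C 0 = 0 := rfl

lemma usage_succ (i : Fin n) :
    usage θ q S C i.succ = usage θ q S C i.castSucc +
      (tried (θ i) (q i) (usage θ q S C i.castSucc) (C i)).indicator (S i) := by
  classical
  ext ω
  rw [Pi.add_apply, indicator_apply, add_ite, add_zero]
  exact if_congr Iff.rfl rfl rfl

lemma usage_congr (k : Fin (n + 1))
    (h : ∀ j : Fin n, j.castSucc < k → θ j = θ' j ∧ q j = q' j) :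
    usage θ q S C k = usage θ' q' S C k := by
  induction k using Fin.induction with
  | zero => rfl
  | succ i ih =>
    obtain ⟨hθ, hq⟩ := h i Fin.castSucc_lt_succ
    rw [usage_succ, usage_succ, ih fun j hj => h j (hj.trans Fin.castSucc_lt_succ), hθ, hq]

/-- The indices of the sizes and coins of the items processed before time `k`. -/
def pastIndices (n : ℕ) (k : Fin (n + 1)) : Set (Fin n ⊕ Fin n) :=
  {x | (x.elim id id).castSucc < k}

lemma measurable_usage (k : Fin (n + 1)) :
    Measurable[info (Sum.elim S C) (pastIndices n k)] (usage θ q S C k) := by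
  induction k using Fin.induction with
  | zero => exact measurable_const
  | succ i ih =>
    have hpast : pastIndices n i.castSucc ⊆ pastIndices n i.succ :=
      fun _ hx => lt_trans hx Fin.castSucc_lt_succ
    let _ : MeasurableSpace Ω := info (Sum.elim S C) (pastIndices n i.succ)
    have hW : Measurable (usage θ q S C i.castSucc) := ih.mono (info_mono hpast) le_rfl
    have hS : Measurable (S i) :=
      measurable_info (X := Sum.elim S C) (i := Sum.inl i) Fin.castSucc_lt_succ
    have hC : Measurable (C i) :=
      measurable_info (X := Sum.elim S C) (i := Sum.inr i) Fin.castSucc_lt_succ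
    rw [usage_succ]
    exact hW.add (hS.indicator (measurableSet_tried hW hC))

variable [MeasurableSpace Ω] {μ : Measure Ω} {F : Fin n → Measure ℝ} {γ : ℝ} {opt : Set ℝ → ℝ}

lemma followsAt_congr {i : Fin n} (h : ∀ j ≤ i, θ j = θ' j ∧ q j = q' j)
    (hi : FollowsAt opt μ γ S C θ q i) : FollowsAt opt μ γ S C θ' q' i := by
  obtain ⟨hθ, hq⟩ := h i le_rfl
  rwa [FollowsAt, ← usage_congr i.castSucc fun j hj => h j (le_of_lt hj), ← hθ, ← hq]

namespace IsRealization

variable (hSC : IsRealization μ F S C)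
include hSC

lemma integral_size (i : Fin n) : ∫ ω, S i ω ∂μ = ∫ s, s ∂F i := by
  rw [← hSC.map_size i]
  exact (integral_map (hSC.measurable_size i).aemeasurable aestronglyMeasurable_id).symm

lemma indepFun_usage_prodMk {i : Fin n} {x y : Fin n ⊕ Fin n}
    (hx : x ∉ pastIndices n i.castSucc) (hxy : x ≠ y) :
    IndepFun (Sum.elim S C x) (fun ω => (usage θ q S C i.castSucc ω, Sum.elim S C y ω)) μ := by
  have hmeas : ∀ z, Measurable (Sum.elim S C z) :=
    Sum.rec hSC.measurable_size hSC.measurable_coin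
  have hdisj : Disjoint {x} (insert y (pastIndices n i.castSucc)) :=
    disjoint_singleton_left.2 (by simp [hx, hxy])
  exact indepFun_of_measurable_info hmeas hSC.indep hdisj (measurable_info (mem_singleton x))
    (((measurable_usage _).mono (info_mono (subset_insert _ _)) le_rfl).prodMk
      (measurable_info (mem_insert _ _)))

lemma isFreshItem (hF : ∀ i, ∀ᵐ s ∂F i, s ∈ Icc (0 : ℝ) 1) (i : Fin n) :
    IsFreshItem μ (usage θ q S C i.castSucc) (S i) (C i) where
  measurable_size := hSC.measurable_size i
  measurable_coin := hSC.measurable_coin i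
  size_mem := ae_of_ae_map (hSC.measurable_size i).aemeasurable (hSC.map_size i ▸ hF i)
  map_coin := hSC.map_coin i
  indep_size := (hSC.indepFun_usage_prodMk (x := Sum.inl i) (y := Sum.inr i)
    (lt_irrefl i.castSucc) Sum.inl_ne_inr).symm
  indep_coin := hSC.indepFun_usage_prodMk (x := Sum.inr i) (y := Sum.inl i)
    (lt_irrefl i.castSucc) Sum.inr_ne_inl

variable [IsProbabilityMeasure μ] (hF : ∀ i, ∀ᵐ s ∂F i, s ∈ Icc (0 : ℝ) 1)
  (hopt : ∀ a ∈ Icc (0 : ℝ) 1, opt (Icc 0 a) ∈ Icc 0 a)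
include hF hopt

lemma isControlled_usage (hγ : 0 ≤ γ) (k : Fin (n + 1))
    (h : ∀ j : Fin n, j.castSucc < k → FollowsAt opt μ γ S C θ q j) :
    IsControlled μ γ (∑ j with j.castSucc < k, ∫ s, s ∂F j) (usage θ q S C k) := by
  induction k using Fin.induction with
  | zero =>
    rw [usage_zero]
    exact ⟨measurable_const, integrable_zero _ _ _, by simp, by simpa [preimage_zero], by simp⟩
  | succ i ih =>
    have hc := ih fun j hj => h j (hj.trans Fin.castSucc_lt_succ)
    have hI : IsFreshItem μ (usage θ q S C i.castSucc) (S i) (C i) := hSC.isFreshItem hF i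
    have hi : FollowsAt opt μ γ S C θ q i := h i Fin.castSucc_lt_succ
    rw [sum_castSucc_lt_succ, ← hSC.integral_size i, usage_succ]
    exact hc.add_indicator_tried hI (hi.mem_thresholdSet hopt hc.measurable).1.1
      (hc.measureReal_tried_inter_fits hI hopt hi).le

lemma measureReal_accepted (hγ : 0 ≤ γ) (h : ∀ i, FollowsAt opt μ γ S C θ q i) (i : Fin n) :
    μ.real (accepted θ q S C i) = γ :=
  (hSC.isControlled_usage hF hopt hγ i.castSucc fun j _ => h j).measureReal_tried_inter_fits
    (hSC.isFreshItem hF i) hopt (h i)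

variable (hmean : γ * (1 + 2 * ∑ i, ∫ s, s ∂F i) ≤ 1)
include hmean

lemma exists_isAggressiveChoice (hγ : 0 ≤ γ) (θ q : Fin n → ℝ) (i : Fin n)
    (h : ∀ j < i, FollowsAt opt μ γ S C θ q j) :
    ∃ t p, IsAggressiveChoice opt μ γ (usage θ q S C i.castSucc) (S i) t p := by
  refine (hSC.isControlled_usage hF hopt hγ i.castSucc h).exists_isAggressiveChoice
    (hSC.isFreshItem hF i) hopt (le_trans ?_ hmean)
  rw [hSC.integral_size i, ← sum_castSucc_lt_succ]
  have hsum : ∑ j with j.castSucc < i.succ, ∫ s, s ∂F j ≤ ∑ j, ∫ s, s ∂F j :=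
    Finset.sum_le_univ_sum_of_nonneg fun j =>
      integral_nonneg_of_ae ((hF j).mono fun _ hs => hs.1)
  gcongr

lemma exists_followsAt (hγ : 0 ≤ γ) : ∃ θ q : Fin n → ℝ, ∀ i, FollowsAt opt μ γ S C θ q i := by
  obtain ⟨f, hf⟩ := exists_forall_of_exists_update
    (P := fun (f : Fin n → ℝ × ℝ) => FollowsAt opt μ γ S C (fun j => (f j).1) fun j => (f j).2)
    (fun f g i h => followsAt_congr fun j hj => ⟨congrArg Prod.fst (h j hj),
      congrArg Prod.snd (h j hj)⟩)
    fun f i h => by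
      obtain ⟨t, p, htp⟩ := hSC.exists_isAggressiveChoice hF hopt hmean hγ _ _ i h
      refine ⟨(t, p), ?_⟩
      rw [FollowsAt, Function.update_self, ← usage_congr i.castSucc fun j hj => ?_]
      · exact htp
      · simp only [Function.update_of_ne (Fin.castSucc_lt_castSucc_iff.1 hj).ne, and_self]
  exact ⟨_, _, hf⟩

end IsRealization

end Policy

end KOCRS

theorem mainTheorem1_general {γ : ℝ} (hγ : 0 ≤ γ) {n : ℕ} {F : Fin n → Measure ℝ}
    (hF : ∀ i, ∀ᵐ s ∂F i, s ∈ Icc (0 : ℝ) 1) (hmean : γ * (1 + 2 * ∑ i, ∫ s, s ∂F i) ≤ 1)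
    {Ω : Type*} [MeasurableSpace Ω] {μ : Measure Ω} [IsProbabilityMeasure μ]
    {S C : Fin n → Ω → ℝ} (hSC : KOCRS.IsRealization μ F S C) {opt : Set ℝ → ℝ}
    (hopt : ∀ a ∈ Icc (0 : ℝ) 1, opt (Icc 0 a) ∈ Icc 0 a) :
    KOCRS.Feasible opt μ γ S C ∧
      ∀ θ q : Fin n → ℝ, (∀ i, KOCRS.FollowsAt opt μ γ S C θ q i) →
        ∀ i, μ.real (KOCRS.accepted θ q S C i) = γ :=
  ⟨⟨hSC.exists_followsAt hF hopt hmean hγ, hSC.exists_isAggressiveChoice hF hopt hmean hγ⟩,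
    fun _ _ => hSC.measureReal_accepted hF hopt hγ⟩

/-- For every `γ ∈ (0,1/3]` and every instance of the hard-constraint problem the `γ`-aggressive
policy is feasible, and it accepts every item with probability exactly `γ`.  This is asserted for
the threshold taken as the infimum, and also for the threshold taken as the supremum, of
`{θ ∈ [0,1] | Pr[θ ≤ W_i ≤ 1 - S_i] ≥ γ}`. -/
theorem mainTheorem1 (γ : ℝ) (hγ : γ ∈ Set.Ioc (0 : ℝ) (1 / 3))
    {n : ℕ} (F : Fin n → MeasureTheory.Measure ℝ) (hF : KOCRS.IsInstance F)
    {Ω : Type*} [MeasurableSpace Ω] (μ : MeasureTheory.Measure Ω)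
    [MeasureTheory.IsProbabilityMeasure μ] (S C : Fin n → Ω → ℝ)
    (hSC : KOCRS.IsRealization μ F S C)
    (opt : Set ℝ → ℝ) (hopt : opt = sInf ∨ opt = sSup) :
    KOCRS.Feasible opt μ γ S C ∧
      ∀ θ q : Fin n → ℝ, (∀ i, KOCRS.FollowsAt opt μ γ S C θ q i) →
        ∀ i, μ.real (KOCRS.accepted θ q S C i) = γ := by
  have hopt_mem : ∀ a ∈ Set.Icc (0 : ℝ) 1, opt (Set.Icc 0 a) ∈ Set.Icc 0 a := by
    rintro a ⟨ha, -⟩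
    rcases hopt with rfl | rfl
    · rwa [csInf_Icc ha, Set.left_mem_Icc]
    · rwa [csSup_Icc ha, Set.right_mem_Icc]
  have hmean : γ * (1 + 2 * ∑ i, ∫ s, s ∂F i) ≤ 1 := by
    nlinarith [hγ.1, hγ.2, hF.sum_mean_le]
  exact mainTheorem1_general hγ.1.le hF.size_mem hmean hSC hopt_mem
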